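/- Conventions. An exact category is an additive category with a Quillen exact structure, i.e. a class of conflations (kernel-cokernel pairs) $X \xrightarrow{i} Y \xrightarrow{d} Z$, closed under isomorphism and satisfying the usual axioms; $i$ is then called an inflation and $d$ a deflation. A model structure on a category is a triple $(\mathrm{Cof},\mathrm{W},\mathrm{Fib})$ of classes of morphisms such that $\mathrm{W}$ is closed under retracts and has the 2-out-of-3 property, and $(\mathrm{Cof},\mathrm{W}\cap\mathrm{Fib})$ and $(\mathrm{Cof}\cap\mathrm{W},\mathrm{Fib})$ are (not necessarily functorial) weak factorization systems. A model category is a category with a model structure that has an initial object, a terminal object, pushouts of trivial cofibrations along trivial cofibrations and pullbacks of trivial fibrations along trivial fibrations. On an exact category, a weak factorization system $(\mathcal{L},\mathcal{R})$ is exact if: $f\in\mathcal{L}$ if and only if $f$ is an inflation and $0\to\operatorname{Coker} f$ is in $\mathcal{L}$; and $f\in\mathcal{R}$ if and only if $f$ is a deflation and $\operatorname{Ker} f\to 0$ is in $\mathcal{R}$. An exact model category is a weakly idempotent complete exact category (every section has a cokernel) with a model structure for which both weak factorization systems are exact. An object $X$ is cofibrant, trivial, or fibrant if, respectively, $0\to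 X$ is a cofibration, $0\to X$ is a weak equivalence, or $X\to 0$ is a fibration. A monoidal model category is a model category with a closed symmetric monoidal structure $(\otimes,\mathbb{1},\mathcal{H}om)$ such that the unit $\mathbb{1}$ is cofibrant and $\otimes$ is a Quillen bifunctor, that is: for all cofibrations $f\colon U\to V$ and $g\colon X\to Y$ the pushout $P$ of $U\otimes Y\leftarrow U\otimes X\to V\otimes X$ exists, the induced map $f\boxtimes g\colon P\to V\otimes Y$ is a cofibration, and $f \boxtimes g$ is a trivial cofibration if moreover $f$ or $g$ is trivial. An exact monoidal model category is an exact model category with a closed symmetric monoidal structure making it a monoidal model category. Theorem. Let $\mathcal{E}$ be an exact model category, and let $\mathcal{C}$, $\mathcal{W}$, $\mathcal{F}$ be its classes of cofibrant, trivial and fibrant objects. Suppose further that $\mathcal{E}$ carries a closed symmetric monoidal structure $(\otimes,\mathbb{1},\mathcal{H}om)$ such that 1. the tensor unit $\mathbb{1}$ is cofibrant; 2. if $X,Y\in\mathcal{C}$, then $X\otimes Y\in\mathcal{C}$; if, moreover, $X$ or $Y$ is in $\mathcal{C}\cap\mathcal{W}$, then $X\otimes Y\in\mathcal{C}\cap\mathcal{W}$;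 3. if $f\colon X\to Y$ is a cofibration and $U\in\mathcal{E}$ is arbitrary, then $U\otimes f\colon U\otimes X\to U\otimes Y$ is an inflation. Then $\mathcal{E}$ with all this structure is an exact monoidal model category. -/

import Mathlib

open CategoryTheory CategoryTheory.Limits CategoryTheory.MonoidalCategory

universe v u

namespace ExactModel

section ExactStructures

/-- A (Quillen) exact structure on an additive category `E`: a class of kernel-cokernel pairs
`X ⟶ Y ⟶ Z`, called conflations, closed under isomorphisms and subject to the usual axioms.
The first map of a conflation is called an inflation, the second one a deflation. -/
structure ExactStructure (E : Type u) [Category.{v} E] [Preadditive E] [HasZeroObject E]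
    [HasBinaryBiproducts E] where
  /-- the conflations -/
  conflation : ObjectProperty (ShortComplex E)
  conflation_of_iso : ∀ {S T : ShortComplex E}, (S ≅ T) → conflation S → conflation T
  isKernel : ∀ {S : ShortComplex E}, conflation S →
    Nonempty (IsLimit (KernelFork.ofι S.f S.zero))
  isCokernel : ∀ {S : ShortComplex E}, conflation S →
    Nonempty (IsColimit (CokernelCofork.ofπ S.g S.zero))
  id_inflation : ∀ X : E, ∃ (Z : E) (d : X ⟶ Z) (w : 𝟙 X ≫ d = 0),
    conflation (ShortComplex.mk (𝟙 X) d w)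
  id_deflation : ∀ Z : E, ∃ (X : E) (i : X ⟶ Z) (w : i ≫ 𝟙 Z = 0),
    conflation (ShortComplex.mk i (𝟙 Z) w)
  comp_inflation : ∀ {X Y Z : E} (i : X ⟶ Y) (j : Y ⟶ Z),
    (∃ (A : E) (d : Y ⟶ A) (w : i ≫ d = 0), conflation (ShortComplex.mk i d w)) →
    (∃ (A : E) (d : Z ⟶ A) (w : j ≫ d = 0), conflation (ShortComplex.mk j d w)) →
    ∃ (A : E) (d : Z ⟶ A) (w : (i ≫ j) ≫ d = 0), conflation (ShortComplex.mk (i ≫ j) d w)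
  comp_deflation : ∀ {X Y Z : E} (p : X ⟶ Y) (q : Y ⟶ Z),
    (∃ (A : E) (i : A ⟶ X) (w : i ≫ p = 0), conflation (ShortComplex.mk i p w)) →
    (∃ (A : E) (i : A ⟶ Y) (w : i ≫ q = 0), conflation (ShortComplex.mk i q w)) →
    ∃ (A : E) (i : A ⟶ X) (w : i ≫ p ≫ q = 0), conflation (ShortComplex.mk i (p ≫ q) w)
  pushout_inflation : ∀ {X Y X' : E} (i : X ⟶ Y) (a : X ⟶ X'),
    (∃ (A : E) (d : Y ⟶ A) (w : i ≫ d = 0), conflation (ShortComplex.mk i d w)) →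
    ∃ (Y' : E) (a' : Y ⟶ Y') (i' : X' ⟶ Y'), IsPushout i a a' i' ∧
      ∃ (A : E) (d : Y' ⟶ A) (w : i' ≫ d = 0), conflation (ShortComplex.mk i' d w)
  pullback_deflation : ∀ {Y Z Z' : E} (p : Y ⟶ Z) (a : Z' ⟶ Z),
    (∃ (A : E) (i : A ⟶ Y) (w : i ≫ p = 0), conflation (ShortComplex.mk i p w)) →
    ∃ (Y' : E) (a' : Y' ⟶ Y) (p' : Y' ⟶ Z'), IsPullback a' p' p a ∧
      ∃ (A : E) (i : A ⟶ Y') (w : i ≫ p' = 0), conflation (ShortComplex.mk i p' w)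

variable {E : Type u} [Category.{v} E] [Preadditive E] [HasZeroObject E]
    [HasBinaryBiproducts E] (S : ExactStructure E)

/-- The class of inflations. -/
def ExactStructure.inflations : MorphismProperty E := fun _ Y i =>
  ∃ (Z : E) (d : Y ⟶ Z) (w : i ≫ d = 0), S.conflation (ShortComplex.mk i d w)

/-- An exact weak factorization system: a weak factorization system `(L, R)` such that `f` is in
`L` iff `f` is an inflation with `0 ⟶ Coker f` in `L`, and `f` is in `R` iff `f` is a deflation
with `Ker f ⟶ 0` in `R`. -/
structure ExactStructure.IsExactWFS (L R : MorphismProperty E) : Prop where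
  isWFS : L.IsWeakFactorizationSystem R
  left_iff : ∀ {X Y : E} (f : X ⟶ Y), L f ↔
    ∃ (Z : E) (d : Y ⟶ Z) (w : f ≫ d = 0),
      S.conflation (ShortComplex.mk f d w) ∧ L (initial.to Z)
  right_iff : ∀ {X Y : E} (f : X ⟶ Y), R f ↔
    ∃ (A : E) (i : A ⟶ X) (w : i ≫ f = 0),
      S.conflation (ShortComplex.mk i f w) ∧ R (terminal.from A)

end ExactStructures

/-- Every section has a cokernel. -/
def IsWeaklyIdempotentComplete (E : Type u) [Category.{v} E] [Preadditive E] : Prop :=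
  ∀ {X Y : E} (s : X ⟶ Y), IsSplitMono s → HasCokernel s

section ModelStructures

/-- A model structure on a category (factorizations are not required to be functorial and no
limits or colimits are required to exist). -/
structure ModelStructure (C : Type u) [Category.{v} C] where
  /-- cofibrations -/
  cof : MorphismProperty C
  /-- weak equivalences -/
  weq : MorphismProperty C
  /-- fibrations -/
  fib : MorphismProperty C
  weq_retracts : weq.IsStableUnderRetracts
  weq_twoOutOfThree : weq.HasTwoOutOfThreeProperty
  wfs_cof_trivFib : cof.IsWeakFactorizationSystem (weq ⊓ fib)
  wfs_trivCof_fib : (cof ⊓ weq).IsWeakFactorizationSystem fib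

namespace ModelStructure

variable {C : Type u} [Category.{v} C] (M : ModelStructure C)

/-- Trivial cofibrations. -/
def trivCof : MorphismProperty C := M.cof ⊓ M.weq

/-- Trivial fibrations. -/
def trivFib : MorphismProperty C := M.weq ⊓ M.fib

/-- A model category is a category with a model structure, an initial object, a terminal object,
pushouts of trivial cofibrations along trivial cofibrations and pullbacks of trivial fibrations
along trivial fibrations. -/
structure IsModelCategory : Prop where
  hasInitial : HasInitial C
  hasTerminal : HasTerminal C
  hasPushout : ∀ {X Y Z : C} (f : X ⟶ Y) (g : X ⟶ Z), M.trivCof f → M.trivCof g → HasPushout f g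
  hasPullback : ∀ {X Y Z : C} (f : X ⟶ Z) (g : Y ⟶ Z), M.trivFib f → M.trivFib g →
    HasPullback f g

/-- The class of cofibrant objects: those `X` for which `∅ ⟶ X` is a cofibration. -/
def cofibrantObjects [HasInitial C] : ObjectProperty C := fun X => M.cof (initial.to X)

/-- The class of trivial objects: those `X` for which `∅ ⟶ X` is a weak equivalence. -/
def trivialObjects [HasInitial C] : ObjectProperty C := fun X => M.weq (initial.to X)

/-- The class of fibrant objects: those `X` for which `X ⟶ *` is a fibration. -/
def fibrantObjects [HasTerminal C] : ObjectProperty C := fun X => M.fib (terminal.from X)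

end ModelStructure

/-- `F` is a Quillen bifunctor: for cofibrations `f : U ⟶ V` and `g : X ⟶ Y`, the pushout `P` of
`F(U, Y) ⟵ F(U, X) ⟶ F(V, X)` exists, the induced map `P ⟶ F(V, Y)` (which is
`Functor.PushoutObjObj.ι`) is a cofibration, and it is trivial if one of `f`, `g` is. -/
structure IsQuillenBifunctor {C D E : Type*} [Category* C] [Category* D] [Category* E]
    (MC : ModelStructure C) (MD : ModelStructure D) (ME : ModelStructure E)
    (F : C ⥤ D ⥤ E) : Prop where
  hasPushout : ∀ {U V : C} {X Y : D} (f : U ⟶ V) (g : X ⟶ Y), MC.cof f → MD.cof g →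
    HasPushout ((F.map f).app X) ((F.obj U).map g)
  cof_ι : ∀ {U V : C} {X Y : D} (f : U ⟶ V) (g : X ⟶ Y), MC.cof f → MD.cof g →
    ∀ sq : F.PushoutObjObj f g, ME.cof sq.ι
  trivCof_ι : ∀ {U V : C} {X Y : D} (f : U ⟶ V) (g : X ⟶ Y), MC.cof f → MD.cof g →
    (MC.weq f ∨ MD.weq g) → ∀ sq : F.PushoutObjObj f g, ME.trivCof sq.ι

/-- A monoidal model category: a model category with a closed symmetric monoidal structure whose
unit is cofibrant and whose tensor product is a Quillen bifunctor. -/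
structure IsMonoidalModelCategory {C : Type u} [Category.{v} C] [MonoidalCategory C]
    [SymmetricCategory C] [MonoidalClosed C] (M : ModelStructure C) : Prop where
  isModelCategory : M.IsModelCategory
  unit_cofibrant : haveI := isModelCategory.hasInitial; M.cofibrantObjects (𝟙_ C)
  tensor_quillen : IsQuillenBifunctor M M M (curriedTensor C)

end ModelStructures

section ExactModelCategories

variable {E : Type u} [Category.{v} E] [Preadditive E] [HasZeroObject E] [HasBinaryBiproducts E]

/-- An exact model category: a weakly idempotent complete exact category with a model structure
whose two weak factorization systems are exact. -/
structure IsExactModelCategory (S : ExactStructure E) (M : ModelStructure E) : Prop where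
  weaklyIdempotentComplete : IsWeaklyIdempotentComplete E
  exact_cof_trivFib : S.IsExactWFS M.cof M.trivFib
  exact_trivCof_fib : S.IsExactWFS M.trivCof M.fib

/-- An exact monoidal model category. -/
structure IsExactMonoidalModelCategory [MonoidalCategory E] [SymmetricCategory E]
    [MonoidalClosed E] (S : ExactStructure E) (M : ModelStructure E) : Prop where
  isExactModelCategory : IsExactModelCategory S M
  isMonoidalModelCategory : IsMonoidalModelCategory M

end ExactModelCategories

end ExactModel

/-!
For cofibrations `f : U ⟶ V` and `g : X ⟶ Y` with cokernels `A` and `B`, the pushout-product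
`P ⟶ V ⊗ Y` fits into a morphism of conflations
```
U ⊗ Y ⟶   P   ⟶ A ⊗ X
  ‖        ↓        ↓
U ⊗ Y ⟶ V ⊗ Y ⟶ A ⊗ Y
```
whose top row is the pushout of `U ⊗ X ⟶ V ⊗ X ⟶ A ⊗ X` along `U ⊗ g`. Its right square is
cartesian, because the left vertical map is an identity. Hence `P ⟶ V ⊗ Y`, being the base change of
the kernel `A ⊗ X ⟶ A ⊗ Y` of `A ⊗ Y ⟶ A ⊗ B`, is the kernel of the deflation
`V ⊗ Y ⟶ A ⊗ Y ⟶ A ⊗ B`. It is thus an inflation with cokernel `A ⊗ B`, and exactness of the two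
weak factorization systems reduces everything to the objects `A`, `B` and `A ⊗ B`.
-/

namespace ExactModel

section KernelsAndCokernels

variable {D : Type*} [Category* D] [HasZeroMorphisms D]

noncomputable def isLimitKernelForkOfIsPullback {X Y X' Y' Z : D} {m : X ⟶ Y} {p : X ⟶ X'}
    {p' : Y ⟶ Y'} {k : X' ⟶ Y'} {e : Y' ⟶ Z} {wk : k ≫ e = 0} (sq : IsPullback m p p' k)
    (hk : IsLimit (KernelFork.ofι k wk)) (w : m ≫ p' ≫ e = 0) :
    IsLimit (KernelFork.ofι m w) :=
  have : Mono k := mono_of_isLimit_fork hk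
  have : Mono m := sq.mono_fst_of_mono
  KernelFork.IsLimit.ofι' m w fun a ha =>
    let l := KernelFork.IsLimit.lift' hk (a ≫ p') (by rw [Category.assoc, ha])
    ⟨sq.lift a l.1 l.2.symm, sq.lift_fst _ _ _⟩

noncomputable def isColimitCokernelCoforkOfIsPushout {X Y X' Y' Z : D} {i : X ⟶ Y} {a : X ⟶ X'}
    {b : Y ⟶ Y'} {i' : X' ⟶ Y'} {d : Y ⟶ Z} {w : i ≫ d = 0} (sq : IsPushout i a b i')
    (hd : IsColimit (CokernelCofork.ofπ d w)) {d' : Y' ⟶ Z} (hb : b ≫ d' = d)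
    (w' : i' ≫ d' = 0) : IsColimit (CokernelCofork.ofπ d' w') :=
  have : Epi d := epi_of_isColimit_cofork hd
  have : Epi d' := epi_of_epi_fac hb
  CokernelCofork.IsColimit.ofπ' d' w' fun t ht =>
    let l := CokernelCofork.IsColimit.desc' hd (b ≫ t) (by
      rw [reassoc_of% sq.w, ht, comp_zero])
    ⟨l.1, sq.hom_ext (by rw [reassoc_of% hb]; exact l.2) (by rw [reassoc_of% w', ht, zero_comp])⟩

end KernelsAndCokernels

namespace ExactStructure

variable {E : Type*} [Category* E] [Preadditive E] [HasZeroObject E] [HasBinaryBiproducts E]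
  {S : ExactStructure E}

variable (S) in
/-- The class of deflations, dual to `ExactStructure.inflations`. -/
def deflations : MorphismProperty E := fun X _ p =>
  ∃ (K : E) (i : K ⟶ X) (w : i ≫ p = 0), S.conflation (ShortComplex.mk i p w)

lemma mono_of_conflation {T : ShortComplex E} (hT : S.conflation T) : Mono T.f :=
  mono_of_isLimit_fork (S.isKernel hT).some

lemma epi_of_conflation {T : ShortComplex E} (hT : S.conflation T) : Epi T.g :=
  epi_of_isColimit_cofork (S.isCokernel hT).some

lemma exists_lift_of_conflation {T : ShortComplex E} (hT : S.conflation T) {A : E} (a : A ⟶ T.X₂)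
    (ha : a ≫ T.g = 0) : ∃ b : A ⟶ T.X₁, b ≫ T.f = a :=
  ⟨_, (KernelFork.IsLimit.lift' (S.isKernel hT).some a ha).2⟩

lemma exists_desc_of_conflation {T : ShortComplex E} (hT : S.conflation T) {A : E} (a : T.X₂ ⟶ A)
    (ha : T.f ≫ a = 0) : ∃ b : T.X₃ ⟶ A, T.g ≫ b = a :=
  ⟨_, (CokernelCofork.IsColimit.desc' (S.isCokernel hT).some a ha).2⟩

lemma conflation_of_isColimit {X Y Z : E} {i : X ⟶ Y} {d : Y ⟶ Z} {w : i ≫ d = 0}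
    (hi : S.inflations i) (hd : IsColimit (CokernelCofork.ofπ d w)) :
    S.conflation (ShortComplex.mk i d w) := by
  obtain ⟨A, d', w', h⟩ := hi
  let hd' := (S.isCokernel h).some
  let e : ShortComplex.mk i d' w' ≅ ShortComplex.mk i d w :=
    ShortComplex.isoMk (Iso.refl _) (Iso.refl _) (hd'.coconePointUniqueUpToIso hd) (by simp)
      (by simpa using (hd'.comp_coconePointUniqueUpToIso_hom hd .one).symm)
  exact S.conflation_of_iso e h

lemma conflation_of_isLimit {K X Y : E} {i : K ⟶ X} {p : X ⟶ Y} {w : i ≫ p = 0}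
    (hp : S.deflations p) (hi : IsLimit (KernelFork.ofι i w)) :
    S.conflation (ShortComplex.mk i p w) := by
  obtain ⟨A, i', w', h⟩ := hp
  let hi' := (S.isKernel h).some
  let e : ShortComplex.mk i' p w' ≅ ShortComplex.mk i p w :=
    ShortComplex.isoMk (hi'.conePointUniqueUpToIso hi) (Iso.refl _) (Iso.refl _)
      (by simpa using hi'.conePointUniqueUpToIso_hom_comp hi .zero) (by simp)
  exact S.conflation_of_iso e h

instance : S.inflations.RespectsIso :=
  MorphismProperty.RespectsIso.of_respects_arrow_iso _ fun i i' e ⟨Z, d, w, h⟩ => by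
    let e₁ : i.left ≅ i'.left := Arrow.leftFunc.mapIso e
    let e₂ : i.right ≅ i'.right := Arrow.rightFunc.mapIso e
    have comm : e₁.hom ≫ i'.hom = i.hom ≫ e₂.hom := Arrow.w e.hom
    have w' : i'.hom ≫ e₂.inv ≫ d = 0 := by
      rw [← cancel_epi e₁.hom, reassoc_of% comm, e₂.hom_inv_id_assoc, w, comp_zero]
    let e' : ShortComplex.mk i.hom d w ≅ ShortComplex.mk i'.hom (e₂.inv ≫ d) w' :=
      ShortComplex.isoMk e₁ e₂ (Iso.refl _) comm (by simp)
    exact ⟨Z, _, w', S.conflation_of_iso e' h⟩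

instance : S.inflations.IsStableUnderCobaseChange :=
  .of_forall_exists_isPullback fun i a _ hi => S.pushout_inflation i a hi

lemma hasPushout_of_inflations {X Y X' : E} {i : X ⟶ Y} (hi : S.inflations i) (a : X ⟶ X') :
    HasPushout i a :=
  let ⟨_, _, _, sq, _⟩ := S.pushout_inflation i a hi
  sq.hasPushout

lemma hasPullback_of_deflations {Y Z Z' : E} {p : Y ⟶ Z} (hp : S.deflations p) (a : Z' ⟶ Z) :
    HasPullback p a :=
  let ⟨_, _, _, sq, _⟩ := S.pullback_deflation p a hp
  sq.hasPullback

lemma conflation_of_isPushout {X Y X' Y' Z : E} {i : X ⟶ Y} {a : X ⟶ X'} {b : Y ⟶ Y'}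
    {i' : X' ⟶ Y'} {d : Y ⟶ Z} {w : i ≫ d = 0} (h : S.conflation (ShortComplex.mk i d w))
    (sq : IsPushout i a b i') {d' : Y' ⟶ Z} (hb : b ≫ d' = d) (w' : i' ≫ d' = 0) :
    S.conflation (ShortComplex.mk i' d' w') :=
  conflation_of_isColimit (MorphismProperty.of_isPushout sq.flip ⟨Z, d, w, h⟩)
    (isColimitCokernelCoforkOfIsPushout sq (S.isCokernel h).some hb w')

lemma conflation_map {E' : Type*} [Category* E'] [Preadditive E'] [HasZeroObject E']
    [HasBinaryBiproducts E'] {S' : ExactStructure E'} (F : E ⥤ E') [F.PreservesZeroMorphisms]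
    {T : ShortComplex E} [PreservesColimit (parallelPair T.f 0) F] (hT : S.conflation T)
    (hF : S'.inflations (F.map T.f)) : S'.conflation (T.map F) :=
  conflation_of_isColimit hF (CokernelCofork.mapIsColimit _ (S.isCokernel hT).some F)

section MorphismOfConflations

variable {A B B' X X' : E} {a : A ⟶ B} {p : B ⟶ X} {a' : A ⟶ B'} {p' : B' ⟶ X'} {m : B ⟶ B'}
  {k : X ⟶ X'} {w : a ≫ p = 0} {w' : a' ≫ p' = 0}

lemma eq_zero_of_conflation_hom (h : S.conflation (ShortComplex.mk a p w))
    (h' : S.conflation (ShortComplex.mk a' p' w')) (ham : a ≫ m = a') {T : E} {t : T ⟶ B}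
    (htm : t ≫ m = 0) (htp : t ≫ p = 0) : t = 0 := by
  have : Mono a' := mono_of_conflation h'
  obtain ⟨s, rfl⟩ : ∃ s, s ≫ a = t := exists_lift_of_conflation h t htp
  have hs : s = 0 := zero_of_comp_mono a' (by rw [← ham, ← Category.assoc, htm])
  rw [hs, zero_comp]

lemma exists_lift_of_conflation_hom (h : S.conflation (ShortComplex.mk a p w))
    (h' : S.conflation (ShortComplex.mk a' p' w')) (ham : a ≫ m = a') (comm : m ≫ p' = p ≫ k)
    {T : E} {t : T ⟶ B'} {s : T ⟶ X} (hts : t ≫ p' = s ≫ k) :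
    ∃ l : T ⟶ B, l ≫ m = t ∧ l ≫ p = s := by
  -- Lift `s` to `r` after base change along a deflation `q`, correct `r` by a map into the kernel
  -- so that it lifts `t` as well, and descend along `q`.
  obtain ⟨T', r, q, sq, K, j, wj, hj⟩ := S.pullback_deflation p s ⟨_, _, _, h⟩
  have : Epi q := epi_of_conflation hj
  obtain ⟨c, hc⟩ : ∃ c, c ≫ a' = q ≫ t - r ≫ m := exists_lift_of_conflation h' _ (by
    simp only [Preadditive.sub_comp, Category.assoc, comm, hts, reassoc_of% sq.w, sub_self])
  let r' := r + c ≫ a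
  have hr'm : r' ≫ m = q ≫ t := by
    simp only [r', Preadditive.add_comp, Category.assoc, ham, hc, add_sub_cancel]
  have hr'p : r' ≫ p = q ≫ s := by
    simp only [r', Preadditive.add_comp, Category.assoc, w, comp_zero, add_zero, sq.w]
  have hjr' : j ≫ r' = 0 := eq_zero_of_conflation_hom h h' ham
    (by rw [Category.assoc, hr'm, reassoc_of% wj, zero_comp])
    (by rw [Category.assoc, hr'p, reassoc_of% wj, zero_comp])
  obtain ⟨l, hl⟩ : ∃ l, q ≫ l = r' := exists_desc_of_conflation hj r' hjr'
  exact ⟨l, by rw [← cancel_epi q, reassoc_of% hl, hr'm],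
    by rw [← cancel_epi q, reassoc_of% hl, hr'p]⟩

lemma isPullback_of_conflation_hom (h : S.conflation (ShortComplex.mk a p w))
    (h' : S.conflation (ShortComplex.mk a' p' w')) (ham : a ≫ m = a') (comm : m ≫ p' = p ≫ k) :
    IsPullback m p p' k := by
  choose lift lift_m lift_p using fun {T : E} (t : T ⟶ B') (s : T ⟶ X) (hts : t ≫ p' = s ≫ k) =>
    exists_lift_of_conflation_hom h h' ham comm hts
  refine ⟨⟨comm⟩, ⟨PullbackCone.IsLimit.mk comm (fun c => lift c.fst c.snd c.condition)
    (fun c => lift_m _ _ _) (fun c => lift_p _ _ _) fun c l hlm hlp => sub_eq_zero.1 ?_⟩⟩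
  exact eq_zero_of_conflation_hom h h' ham
    (by rw [Preadditive.sub_comp, hlm, lift_m, sub_self])
    (by rw [Preadditive.sub_comp, hlp, lift_p, sub_self])

lemma conflation_of_conflation_hom (h : S.conflation (ShortComplex.mk a p w))
    (h' : S.conflation (ShortComplex.mk a' p' w')) (ham : a ≫ m = a') (comm : m ≫ p' = p ≫ k)
    {Z : E} {e : X' ⟶ Z} {wk : k ≫ e = 0} (hk : S.conflation (ShortComplex.mk k e wk))
    (wm : m ≫ p' ≫ e = 0) : S.conflation (ShortComplex.mk m (p' ≫ e) wm) :=
  conflation_of_isLimit (S.comp_deflation p' e ⟨_, _, _, h'⟩ ⟨_, _, _, hk⟩)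
    (isLimitKernelForkOfIsPullback (isPullback_of_conflation_hom h h' ham comm)
      (S.isKernel hk).some wm)

end MorphismOfConflations

namespace IsExactWFS

variable {L R : MorphismProperty E}

lemma left_le_inflations (h : S.IsExactWFS L R) : L ≤ S.inflations := fun _ _ f hf =>
  let ⟨Z, d, w, hd, _⟩ := (h.left_iff f).1 hf
  ⟨Z, d, w, hd⟩

lemma right_le_deflations (h : S.IsExactWFS L R) : R ≤ S.deflations := fun _ _ f hf =>
  let ⟨K, i, w, hi, _⟩ := (h.right_iff f).1 hf
  ⟨K, i, w, hi⟩

lemma left_iff_of_conflation (h : S.IsExactWFS L R) {X Y Z : E} {f : X ⟶ Y} {d : Y ⟶ Z}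
    {w : f ≫ d = 0} (hd : S.conflation (ShortComplex.mk f d w)) : L f ↔ L (initial.to Z) := by
  refine ⟨fun hf => ?_, fun hZ => (h.left_iff f).2 ⟨Z, d, w, hd, hZ⟩⟩
  obtain ⟨Z', d', w', hd', hZ'⟩ := (h.left_iff f).1 hf
  have := h.isWFS
  have : L.RespectsIso := MorphismProperty.llp_eq_of_wfs L R ▸ inferInstance
  let e : Z' ≅ Z := (S.isCokernel hd').some.coconePointUniqueUpToIso (S.isCokernel hd).some
  rw [← initial.to_comp e.hom]
  exact (L.cancel_right_of_respectsIso _ _).2 hZ'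

end IsExactWFS

end ExactStructure

namespace IsExactModelCategory

variable {E : Type*} [Category* E] [Preadditive E] [HasZeroObject E] [HasBinaryBiproducts E]
  {S : ExactStructure E} {M : ModelStructure E}

lemma cof_iff_of_conflation (hM : IsExactModelCategory S M) {X Y Z : E} {f : X ⟶ Y} {d : Y ⟶ Z}
    {w : f ≫ d = 0} (hd : S.conflation (ShortComplex.mk f d w)) :
    M.cof f ↔ M.cofibrantObjects Z :=
  hM.exact_cof_trivFib.left_iff_of_conflation hd

lemma trivCof_iff_of_conflation (hM : IsExactModelCategory S M) {X Y Z : E} {f : X ⟶ Y}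
    {d : Y ⟶ Z} {w : f ≫ d = 0} (hd : S.conflation (ShortComplex.mk f d w)) :
    M.trivCof f ↔ M.cofibrantObjects Z ∧ M.trivialObjects Z :=
  hM.exact_trivCof_fib.left_iff_of_conflation hd

lemma exists_conflation_of_cof (hM : IsExactModelCategory S M) {X Y : E} {f : X ⟶ Y}
    (hf : M.cof f) :
    ∃ (Z : E) (d : Y ⟶ Z) (w : f ≫ d = 0), S.conflation (ShortComplex.mk f d w) ∧
      M.cofibrantObjects Z ∧ (M.weq f → M.trivialObjects Z) := by
  obtain ⟨Z, d, w, hd⟩ := hM.exact_cof_trivFib.left_le_inflations f hf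
  exact ⟨Z, d, w, hd, (hM.cof_iff_of_conflation hd).1 hf,
    fun hw => ((hM.trivCof_iff_of_conflation hd).1 ⟨hf, hw⟩).2⟩

lemma isModelCategory (hM : IsExactModelCategory S M) : M.IsModelCategory where
  hasInitial := inferInstance
  hasTerminal := inferInstance
  hasPushout f g hf _ :=
    ExactStructure.hasPushout_of_inflations (hM.exact_trivCof_fib.left_le_inflations f hf) g
  hasPullback f g hf _ :=
    ExactStructure.hasPullback_of_deflations (hM.exact_cof_trivFib.right_le_deflations f hf) g

end IsExactModelCategory

section Bifunctors

variable {E₁ E₂ E₃ : Type*} [Category* E₁] [Category* E₂] [Category* E₃]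
  [Preadditive E₁] [Preadditive E₂] [Preadditive E₃]
  [HasZeroObject E₁] [HasZeroObject E₂] [HasZeroObject E₃]
  [HasBinaryBiproducts E₁] [HasBinaryBiproducts E₂] [HasBinaryBiproducts E₃]
  {S₁ : ExactStructure E₁} {S₂ : ExactStructure E₂} {S₃ : ExactStructure E₃}
  (F : E₁ ⥤ E₂ ⥤ E₃)
  [∀ X, (F.obj X).PreservesZeroMorphisms] [∀ Y, (F.flip.obj Y).PreservesZeroMorphisms]
  [∀ X, PreservesColimitsOfShape WalkingParallelPair (F.obj X)]
  [∀ Y, PreservesColimitsOfShape WalkingParallelPair (F.flip.obj Y)]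

variable {F} in
lemma ExactStructure.exists_conflation_pushoutObjObj_ι {U V A : E₁} {X Y B : E₂} {f : U ⟶ V}
    {p : V ⟶ A} {wf : f ≫ p = 0} {g : X ⟶ Y} {q : Y ⟶ B} {wg : g ≫ q = 0}
    (hf : S₁.conflation (ShortComplex.mk f p wf)) (hg : S₂.conflation (ShortComplex.mk g q wg))
    (hfX : S₃.inflations ((F.map f).app X)) (hfY : S₃.inflations ((F.map f).app Y))
    (hgA : S₃.inflations ((F.obj A).map g)) (sq : F.PushoutObjObj f g) :
    ∃ w : sq.ι ≫ (F.map p).app Y ≫ (F.obj A).map q = 0,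
      S₃.conflation (ShortComplex.mk sq.ι ((F.map p).app Y ≫ (F.obj A).map q) w) := by
  have confX := conflation_map (F.flip.obj X) hf hfX
  have confY := conflation_map (F.flip.obj Y) hf hfY
  have confA := conflation_map (F.obj A) hg hgA
  have zeroX : (F.map f).app X ≫ (F.map p).app X = 0 :=
    ((ShortComplex.mk f p wf).map (F.flip.obj X)).zero
  have zeroY : (F.map f).app Y ≫ (F.map p).app Y = 0 :=
    ((ShortComplex.mk f p wf).map (F.flip.obj Y)).zero
  have zeroA : (F.obj A).map g ≫ (F.obj A).map q = 0 :=
    ((ShortComplex.mk g q wg).map (F.obj A)).zero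
  let r : sq.pt ⟶ (F.obj A).obj X :=
    sq.isPushout.desc ((F.map p).app X) 0 (by rw [zeroX, comp_zero])
  have inl_r : sq.inl ≫ r = (F.map p).app X := sq.isPushout.inl_desc _ _ _
  have inr_r : sq.inr ≫ r = 0 := sq.isPushout.inr_desc _ _ _
  have conf_r : S₃.conflation (ShortComplex.mk sq.inr r inr_r) :=
    conflation_of_isPushout confX sq.isPushout inl_r inr_r
  have comm : sq.ι ≫ (F.map p).app Y = r ≫ (F.obj A).map g := sq.hom_ext
    (by rw [sq.inl_ι_assoc, reassoc_of% inl_r, NatTrans.naturality])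
    (by rw [sq.inr_ι_assoc, reassoc_of% inr_r, zeroY, zero_comp])
  have w : sq.ι ≫ (F.map p).app Y ≫ (F.obj A).map q = 0 := by
    rw [reassoc_of% comm, zeroA, comp_zero]
  exact ⟨w, conflation_of_conflation_hom conf_r confY sq.inr_ι comm confA w⟩

variable {M₁ : ModelStructure E₁} {M₂ : ModelStructure E₂} {M₃ : ModelStructure E₃}

theorem IsExactModelCategory.isQuillenBifunctor (hM₁ : IsExactModelCategory S₁ M₁)
    (hM₂ : IsExactModelCategory S₂ M₂) (hM₃ : IsExactModelCategory S₃ M₃)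
    (cofibrant_obj : ∀ A B, M₁.cofibrantObjects A → M₂.cofibrantObjects B →
      M₃.cofibrantObjects ((F.obj A).obj B))
    (trivial_obj : ∀ A B, M₁.cofibrantObjects A → M₂.cofibrantObjects B →
      (M₁.trivialObjects A ∨ M₂.trivialObjects B) → M₃.trivialObjects ((F.obj A).obj B))
    (inflations_map_app : ∀ {U V : E₁} (f : U ⟶ V) (X : E₂), M₁.cof f →
      S₃.inflations ((F.map f).app X))
    (inflations_obj_map : ∀ (A : E₁) {X Y : E₂} (g : X ⟶ Y), M₁.cofibrantObjects A → M₂.cof g →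
      S₃.inflations ((F.obj A).map g)) :
    IsQuillenBifunctor M₁ M₂ M₃ F where
  hasPushout f g hf _ := ExactStructure.hasPushout_of_inflations (inflations_map_app f _ hf) _
  cof_ι f g hf hg sq := by
    obtain ⟨A, p, _, hp, hA, -⟩ := hM₁.exists_conflation_of_cof hf
    obtain ⟨B, q, _, hq, hB, -⟩ := hM₂.exists_conflation_of_cof hg
    obtain ⟨_, hι⟩ := ExactStructure.exists_conflation_pushoutObjObj_ι hp hq
      (inflations_map_app f _ hf) (inflations_map_app f _ hf) (inflations_obj_map A g hA hg) sq
    exact (hM₃.cof_iff_of_conflation hι).2 (cofibrant_obj A B hA hB)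
  trivCof_ι f g hf hg hfg sq := by
    obtain ⟨A, p, _, hp, hA, trivial_A⟩ := hM₁.exists_conflation_of_cof hf
    obtain ⟨B, q, _, hq, hB, trivial_B⟩ := hM₂.exists_conflation_of_cof hg
    obtain ⟨_, hι⟩ := ExactStructure.exists_conflation_pushoutObjObj_ι hp hq
      (inflations_map_app f _ hf) (inflations_map_app f _ hf) (inflations_obj_map A g hA hg) sq
    exact (hM₃.trivCof_iff_of_conflation hι).2
      ⟨cofibrant_obj A B hA hB, trivial_obj A B hA hB (hfg.imp trivial_A trivial_B)⟩

end Bifunctors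

lemma whiskerRight_iff_whiskerLeft {E : Type*} [Category* E] [MonoidalCategory E]
    [BraidedCategory E] (P : MorphismProperty E) [P.RespectsIso] {X Y : E} (f : X ⟶ Y) (U : E) :
    P (f ▷ U) ↔ P (U ◁ f) :=
  P.arrow_mk_iso_iff (Arrow.isoMk (β_ X U) (β_ Y U) (by simp))

end ExactModel

theorem mainTheorem11 {E : Type u} [Category.{v} E] [Preadditive E] [HasZeroObject E]
    [HasBinaryBiproducts E] [MonoidalCategory E] [SymmetricCategory E] [MonoidalClosed E]
    (S : ExactModel.ExactStructure E) (M : ExactModel.ModelStructure E)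
    (hM : ExactModel.IsExactModelCategory S M)
    (C W F : ObjectProperty E)
    (hC : C = M.cofibrantObjects) (hW : W = M.trivialObjects) (hF : F = M.fibrantObjects)
    (unit_cofibrant : C (𝟙_ E))
    (tensor_cofibrant : ∀ X Y : E, C X → C Y → C (X ⊗ Y))
    (tensor_trivial : ∀ X Y : E, C X → C Y → (W X ∨ W Y) → C (X ⊗ Y) ∧ W (X ⊗ Y))
    (tensor_inflation : ∀ (U : E) {X Y : E} (f : X ⟶ Y), M.cof f → S.inflations (U ◁ f)) :
    ExactModel.IsExactMonoidalModelCategory S M := by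
  subst hC hW
  have inflations_whiskerRight {X Y : E} (f : X ⟶ Y) (U : E) (hf : M.cof f) :
      S.inflations (f ▷ U) :=
    (ExactModel.whiskerRight_iff_whiskerLeft _ f U).2 (tensor_inflation U f hf)
  have tensor_quillen : ExactModel.IsQuillenBifunctor M M M (curriedTensor E) :=
    hM.isQuillenBifunctor (curriedTensor E) hM hM tensor_cofibrant
      (fun X Y hX hY hXY => (tensor_trivial X Y hX hY hXY).2)
      inflations_whiskerRight (fun U _ _ f _ hf => tensor_inflation U f hf)
  exact ⟨hM, hM.isModelCategory, unit_cofibrant, tensor_quillen⟩
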